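/- **Conventions.** An address is a finite word of natural numbers; two addresses are disjoint if neither is a prefix of the other; $\xi i$ is the word $\xi$ followed by $i$, and $\xi\star J=\{\xi j\mid j\in J\}$. $I,J$ range over finite subsets of $\mathbb N$. *Designs.* Positive and negative pseudo-designs are the possibly infinitely deep trees given by $$\phi::=\Omega\mid ✠\mid(+,\xi,I)\cdot\{\psi_{\xi i}\mid i\in I\},\qquad \psi_\zeta::=\{(-,\zeta,J)\phi_J\mid J\subseteq\mathbb N\text{ finite}\};$$ $\zeta$ is called the address of $\psi_\zeta$, and $\psi_{\zeta,J}$ denotes $\phi_J$. A base $\vdash\Lambda$ (resp. $\zeta\vdash\Lambda$), where $\Lambda$ is a finite set of addresses, is well formed if all its addresses are pairwise disjoint. Typing is given by the following rules, whose derivations may be infinitely deep: $\Omega:(\vdash\Lambda)$ and $✠:(\vdash\Lambda)$ if $\vdash\Lambda$ is well formed; $(+,\xi,I)\cdot\{\psi_{\xi i}\}:(\vdash\xi,\Lambda)$ if $\vdash\xi,\Lambda$ is well formed and $\psi_{\xi i}:(\xi i\vdash\Lambda_i)$ for each $i\in I$, with pairwise disjoint sets $\Lambda_i\subseteq\Lambda$;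 $\{(-,\zeta,J)\phi_J\}:(\zeta\vdash\Lambda)$ if $\zeta\vdash\Lambda$ is well formed and for each $J$ there is $\Lambda_J\subseteq\Lambda$ with $\phi_J:(\vdash\zeta\star J,\Lambda_J)$. Designs are the typable pseudo-designs (the partial design $\Omega$ is allowed below). *Observational order.* $\sqsubseteq$ is the greatest relation such that $\phi\sqsubseteq\phi'$ implies that $\phi=\Omega$, or $\phi'=✠$, or $\phi=(+,\xi,I)\cdot\{\psi_{\xi i}\}$ and $\phi'=(+,\xi,I)\cdot\{\psi'_{\xi i}\}$ with $\psi_{\xi i}\sqsubseteq\psi'_{\xi i}$ for all $i\in I$; for negative pseudo-designs, $\psi\sqsubseteq\psi'$ means that they have the same address $\zeta$ and $\psi_{\zeta,J}\sqsubseteq\psi'_{\zeta,J}$ for all $J$. *Nets.* A positive design $\phi$ and finitely many negative designs $\psi_1,\dots,\psi_n$ form a net if they have bases such that: the addresses in these bases are pairwise disjoint or equal; an address appears at most twice in these bases; if it appears twice, it appears once on the left and once on the right of $\vdash$ (it is then called a cut); and the (multi)graph whose vertices are the $n+1$ bases and whose edges are the cuts is acyclic. *Normalization.* States are pairs $\langle\phi\mid\Psi\rangle$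 with $\Psi$ a finite set of negative pseudo-designs with distinct addresses; $\Psi$ accepts $\xi$ if it has an element $\Psi_\xi$ of address $\xi$. Weak reduction is $$\langle(+,\xi,I)\cdot\Psi'\mid\Psi\rangle\longrightarrow\langle\Psi_{\xi,I}\mid\Psi'\cup(\Psi\setminus\{\Psi_\xi\})\rangle\quad\text{if }\Psi\text{ accepts }\xi .$$ The normal form of a state is the possibly infinite positive pseudo-design determined as follows. If weak reduction from the state does not terminate, the normal form is $\Omega$. If it stops at $\langle\Omega\mid\Psi\rangle$ or $\langle✠\mid\Psi\rangle$, the normal form is $\Omega$ or $✠$, respectively. If it stops at $\langle(+,\xi,I)\cdot\Psi'\mid\Psi\rangle$ (so $\Psi$ does not accept $\xi$), the root of the normal form is $(+,\xi,I)$, and for $i\in I$ and $J$ finite, its subtree above $(-,\xi i,J)$ is the normal form of $\langle\Psi'_{\xi i,J}\mid\Psi\rangle$. We write $[\![\phi,\{\psi_1,\dots,\psi_n\}]\!]$ for the normal form of $\langle\phi\mid\{\psi_1,\dots,\psi_n\}\rangle$. **Theorem (Monotonicity).** Let $n\ge 0$, and suppose that $\phi_1$ with $\psi_{1,1},\dots,\psi_{1,n}$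 and $\phi_2$ with $\psi_{2,1},\dots,\psi_{2,n}$ are nets. If $\phi_1\sqsubseteq\phi_2$ and $\psi_{1,i}\sqsubseteq\psi_{2,i}$ for $i=1,\dots,n$, then $$[\![\phi_1,\{\psi_{1,1},\dots,\psi_{1,n}\}]\!]\sqsubseteq[\![\phi_2,\{\psi_{2,1},\dots,\psi_{2,n}\}]\!].$$ -/

import Mathlib

namespace Ludics

/-- Addresses (loci): finite words of natural numbers. The address `ξ i` is `ξ ++ [i]`. -/
abbrev Addr : Type := List ℕ

/-- Two addresses are disjoint when neither is a prefix of the other. -/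
def Addr.Disj (a b : Addr) : Prop := ¬ a <+: b ∧ ¬ b <+: a

/-- `ξ ⋆ J = {ξ j | j ∈ J}`. -/
def Addr.star (ξ : Addr) (J : Finset ℕ) : Finset Addr := J.image fun j => ξ ++ [j]

/-! ### Pseudo-designs -/

/-- The possible roots of a positive pseudo-design: `Ω`, the daimon, or an action `(+, ξ, I)`. -/
inductive PosShape : Type
  | omega : PosShape
  | daimon : PosShape
  | act (ξ : Addr) (I : Finset ℕ) : PosShape

/-- The subtrees above a root: `Ω` and the daimon are leaves, `(+, ξ, I)` has one positive
subtree for each `i ∈ I` and each finite set `J` of natural numbers. -/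
abbrev PosShape.Child : PosShape → Type
  | .omega => Empty
  | .daimon => Empty
  | .act _ I => I × Finset ℕ

/-- The polynomial functor of the grammar of positive pseudo-designs. -/
abbrev PosF : PFunctor := ⟨PosShape, PosShape.Child⟩

/-- Positive pseudo-designs `φ ::= Ω | ✠ | (+, ξ, I) · {ψ_{ξ i} | i ∈ I}`, where
`ψ_ζ ::= {(-, ζ, J) φ_J | J finite}`. The grammar is read coinductively: designs of infinite
depth are included. -/
abbrev Pos : Type := PosF.M

/-- Negative pseudo-designs `ψ_ζ = {(-, ζ, J) φ_J | J finite}`; `branch J` is `φ_J`. -/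
structure Neg : Type where
  addr : Addr
  branch : Finset ℕ → Pos

/-- The root `Ω`, without subtrees. -/
def omegaNode (X : Type) : PosF X := ⟨PosShape.omega, fun e => Empty.elim e⟩

/-- The root `✠`, without subtrees. -/
def daimonNode (X : Type) : PosF X := ⟨PosShape.daimon, fun e => Empty.elim e⟩

/-- The root `(+, ξ, I)`, with the subtree `c i J` above the negative action `(-, ξ i, J)`. -/
def actNode {X : Type} (ξ : Addr) (I : Finset ℕ) (c : I → Finset ℕ → X) : PosF X :=
  ⟨PosShape.act ξ I, fun p => c p.1 p.2⟩

/-- The partial design `Ω`. -/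
def Pos.omega : Pos := PFunctor.M.mk (omegaNode Pos)

/-- The daimon `✠`. -/
def Pos.daimon : Pos := PFunctor.M.mk (daimonNode Pos)

/-- The pseudo-design `(+, ξ, I) · {ψ_{ξ i} | i ∈ I}` with `ψ_{ξ i} = {(-, ξ i, J) (c i J) | J}`. -/
def Pos.act (ξ : Addr) (I : Finset ℕ) (c : I → Finset ℕ → Pos) : Pos :=
  PFunctor.M.mk (actNode ξ I c)

/-! ### Typing: designs -/

/-- The base `⊢ Λ` is well formed: its addresses are pairwise disjoint. -/
def WFPos (Λ : Finset Addr) : Prop := (Λ : Set Addr).Pairwise Addr.Disj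

/-- The base `ζ ⊢ Λ` is well formed. -/
def WFNeg (ζ : Addr) (Λ : Finset Addr) : Prop := WFPos Λ ∧ ∀ a ∈ Λ, Addr.Disj ζ a

/-- Negative typing rule with conclusion `{(-, ζ, J) (b J) | J} : (ζ ⊢ Λ)`; the premises are
judged by `R`. -/
def NegRule (R : Pos → Finset Addr → Prop) (ζ : Addr) (b : Finset ℕ → Pos)
    (Λ : Finset Addr) : Prop :=
  WFNeg ζ Λ ∧ ∀ J : Finset ℕ, ∃ Δ : Finset Addr, Δ ⊆ Λ ∧ R (b J) (ζ.star J ∪ Δ)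

/-- `φ : (⊢ Λ)` is the conclusion of a positive typing rule (possibly followed upwards by negative
rules) whose positive premises are judged by `R`. -/
def PosRule (R : Pos → Finset Addr → Prop) (φ : Pos) (Λ : Finset Addr) : Prop :=
  WFPos Λ ∧
    (φ = Pos.omega ∨ φ = Pos.daimon ∨
      ∃ (ξ : Addr) (I : Finset ℕ) (c : I → Finset ℕ → Pos) (Γ : Finset Addr)
        (Δ : I → Finset Addr),
        φ = Pos.act ξ I c ∧ Λ = insert ξ Γ ∧ ξ ∉ Γ ∧ (∀ i, Δ i ⊆ Γ) ∧
        (∀ i j, i ≠ j → Disjoint (Δ i) (Δ j)) ∧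
        ∀ i : I, NegRule R (ξ ++ [(i : ℕ)]) (c i) (Δ i))

/-- `φ : (⊢ Λ)`. Typing derivations may have infinite depth, as designs do: this is the greatest
relation in which every judgement is the conclusion of a typing rule. -/
def Pos.HasBase (φ : Pos) (Λ : Finset Addr) : Prop :=
  ∃ R : Pos → Finset Addr → Prop, R φ Λ ∧ ∀ φ' Λ', R φ' Λ' → PosRule R φ' Λ'

/-- `ψ : (ζ ⊢ Λ)`, where `ζ` is the address of `ψ`. -/
def Neg.HasBase (ψ : Neg) (Λ : Finset Addr) : Prop :=
  NegRule Pos.HasBase ψ.addr ψ.branch Λ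

/-! ### The observational order -/

/-- The observational order `φ₁ ⊑ φ₂` on positive pseudo-designs: the greatest relation generated
by the rules `Ω ⊑ φ`, `φ ⊑ ✠` and compatibility with the actions. -/
def Pos.ObsLE (φ₁ φ₂ : Pos) : Prop :=
  ∃ R : Pos → Pos → Prop, R φ₁ φ₂ ∧ ∀ φ φ', R φ φ' →
    φ = Pos.omega ∨ φ' = Pos.daimon ∨
      ∃ (ξ : Addr) (I : Finset ℕ) (c c' : I → Finset ℕ → Pos),
        φ = Pos.act ξ I c ∧ φ' = Pos.act ξ I c' ∧ ∀ i J, R (c i J) (c' i J)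

/-! The relation is reflexive and transitive, so these need not be added as rules. -/

theorem act_inj {ξ ξ' : Addr} {I I' : Finset ℕ} {c : I → Finset ℕ → Pos}
    {c' : I' → Finset ℕ → Pos} (h : Pos.act ξ I c = Pos.act ξ' I' c') :
    ξ = ξ' ∧ I = I' ∧ HEq c c' := by
  have := PFunctor.M.mk_inj h
  obtain ⟨h1, h2⟩ := Sigma.mk.inj_iff.1 this
  obtain ⟨rfl, rfl⟩ := PosShape.act.inj h1
  refine ⟨rfl, rfl, ?_⟩
  have h3 := eq_of_heq h2
  apply heq_of_eq
  funext i J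
  exact congrFun h3 (i, J)
theorem act_ne_omega {ξ : Addr} {I : Finset ℕ} {c : I → Finset ℕ → Pos} :
    Pos.act ξ I c ≠ Pos.omega := by
  intro h; have := congrArg Sigma.fst (PFunctor.M.mk_inj h); cases this
theorem act_ne_daimon {ξ : Addr} {I : Finset ℕ} {c : I → Finset ℕ → Pos} :
    Pos.act ξ I c ≠ Pos.daimon := by
  intro h; have := congrArg Sigma.fst (PFunctor.M.mk_inj h); cases this
theorem omega_ne_daimon : Pos.omega ≠ Pos.daimon := by
  intro h; have := congrArg Sigma.fst (PFunctor.M.mk_inj h); cases this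

theorem cases_pos (φ : Pos) :
    φ = Pos.omega ∨ φ = Pos.daimon ∨ ∃ ξ I c, φ = Pos.act ξ I c := by
  rw [← PFunctor.M.mk_dest φ]
  rcases hh : PFunctor.M.dest φ with ⟨_ | _ | ⟨ξ, I⟩, c⟩
  · left; unfold Pos.omega omegaNode; congr 2; funext e; exact Empty.elim e
  · right; left; unfold Pos.daimon daimonNode; congr 2; funext e; exact Empty.elim e
  · right; right; exact ⟨ξ, I, fun i J => c (i, J), rfl⟩

theorem Pos.ObsLE.unfold {φ φ' : Pos} (h : Pos.ObsLE φ φ') : φ = Pos.omega ∨ φ' = Pos.daimon ∨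
      ∃ (ξ : Addr) (I : Finset ℕ) (c c' : I → Finset ℕ → Pos),
        φ = Pos.act ξ I c ∧ φ' = Pos.act ξ I c' ∧ ∀ i J, Pos.ObsLE (c i J) (c' i J) := by
  obtain ⟨R, h, hR⟩ := h
  rcases hR _ _ h with h | h | ⟨ξ, I, c, c', h1, h2, h3⟩
  · exact .inl h
  · exact .inr (.inl h)
  · exact .inr (.inr ⟨ξ, I, c, c', h1, h2, fun i J => ⟨R, h3 i J, hR⟩⟩)

theorem Pos.ObsLE.refl (φ : Pos) : Pos.ObsLE φ φ := ⟨Eq, rfl, by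
  rintro φ _ rfl
  rcases cases_pos φ with h | h | ⟨ξ, I, c, h⟩
  · exact .inl h
  · exact .inr (.inl h)
  · exact .inr (.inr ⟨ξ, I, c, c, h, h, fun _ _ => rfl⟩)⟩

theorem Pos.ObsLE.trans {a b c : Pos} (h : Pos.ObsLE a b) (h' : Pos.ObsLE b c) : Pos.ObsLE a c := by
  refine ⟨fun x z => ∃ y, Pos.ObsLE x y ∧ Pos.ObsLE y z, ⟨b, h, h'⟩, ?_⟩
  rintro x z ⟨y, h, h'⟩
  rcases Pos.ObsLE.unfold h with h | h | ⟨ξ, I, c, c', h1, h2, h3⟩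
  · exact .inl h
  · rcases Pos.ObsLE.unfold h' with g | g | ⟨ξ', I', d, d', g1, g2, g3⟩
    · exact absurd (g.symm.trans h) omega_ne_daimon
    · exact .inr (.inl g)
    · exact absurd (g1.symm.trans h) act_ne_daimon
  · rcases Pos.ObsLE.unfold h' with g | g | ⟨ξ', I', d, d', g1, g2, g3⟩
    · exact absurd (h2.symm.trans g) act_ne_omega
    · exact .inr (.inl g)
    · obtain ⟨rfl, rfl, e⟩ := act_inj (h2.symm.trans g1)
      cases e
      exact .inr (.inr ⟨_, _, _, _, h1, g2, fun i J => ⟨_, h3 i J, g3 i J⟩⟩)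

/-- The observational order `ψ₁ ⊑ ψ₂` on negative pseudo-designs. -/
def Neg.ObsLE (ψ₁ ψ₂ : Neg) : Prop :=
  ψ₁.addr = ψ₂.addr ∧ ∀ J, Pos.ObsLE (ψ₁.branch J) (ψ₂.branch J)

/-! ### Normalization -/

/-- Environments of the machine: finite sets `Ψ` of negative pseudo-designs with distinct
addresses, seen as partial maps. `Ψ` accepts `ζ` when `Ψ ζ ≠ none`, and then `Ψ ζ = some b` with
`Ψ_ζ = {(-, ζ, J) (b J) | J}`. -/
abbrev Env : Type := Addr → Option (Finset ℕ → Pos)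

open Classical in
/-- The environment `{ψ i | i}` given by a family of negative pseudo-designs with distinct
addresses. -/
noncomputable def Env.ofFamily {ι : Type} (ψ : ι → Neg) : Env := fun ζ =>
  if h : ∃ i, (ψ i).addr = ζ then some (ψ h.choose).branch else none

/-- `Ψ ∖ ξ`. -/
def Env.erase (Ψ : Env) (ξ : Addr) : Env := fun ζ => if ζ = ξ then none else Ψ ζ

/-- `Ψ' ∪ Ψ`, for environments with disjoint domains. -/
def Env.union (Ψ' Ψ : Env) : Env := fun ζ => (Ψ' ζ).or (Ψ ζ)

/-- States `⟨φ | Ψ⟩` of the machine. -/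
structure State : Type where
  code : Pos
  env : Env

/-- The weak reduction rule
`⟨(+, ξ, I) · Ψ' | Ψ⟩ ⟶ ⟨Ψ_{ξ, I} | Ψ' ∪ (Ψ ∖ ξ)⟩`, if `Ψ` accepts `ξ`. -/
inductive Red : State → State → Prop
  | rule (ξ : Addr) (I : Finset ℕ) (c : I → Finset ℕ → Pos) (Ψ : Env)
      (b : Finset ℕ → Pos) (hb : Ψ ξ = some b) :
      Red ⟨Pos.act ξ I c, Ψ⟩
        ⟨b I, (Env.ofFamily fun i : I => ⟨ξ ++ [(i : ℕ)], c i⟩).union (Ψ.erase ξ)⟩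

/-- The weak reduction of `s` stops in the state `t`. -/
def StopsAt (s t : State) : Prop := Relation.ReflTransGen Red s t ∧ ∀ u, ¬ Red t u

open Classical in
/-- The root of the normal form of a state, with the states from which its subtrees are to be
computed. If weak reduction does not stop, the root is `Ω`. If it stops in `⟨Ω | Ψ⟩` or in
`⟨✠ | Ψ⟩`, the root is `Ω` or `✠`. If it stops in `⟨(+, ξ, I) · Ψ' | Ψ⟩`, where `Ψ` does not accept
`ξ`, the root is `(+, ξ, I)`, and (strong reduction) the subtree above `(-, ξ i, J)` is computed
from the state `⟨Ψ'_{ξ i, J} | Ψ⟩`. -/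
noncomputable def head (s : State) : PosF State :=
  if h : ∃ t, StopsAt s t then
    PosF.map (fun φ => (⟨φ, h.choose.env⟩ : State)) (PFunctor.M.dest h.choose.code)
  else omegaNode State

/-- The normal form of a state, computed on demand from its root upwards. -/
noncomputable def State.normalForm (s : State) : Pos := PFunctor.M.corec head s

/-- The normal form `⟦φ, {ψ_1, …, ψ_n}⟧`. -/
noncomputable def normalForm {n : ℕ} (φ : Pos) (ψ : Fin n → Neg) : Pos :=
  State.normalForm ⟨φ, Env.ofFamily ψ⟩

/-! ### Nets -/

/-- The addresses on the left of `⊢` in the bases of a net; the vertex `none` stands for the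
positive design, the vertex `some i` for `ψ i`. -/
def netLeft {n : ℕ} (ψ : Fin n → Neg) : Option (Fin n) → Finset Addr
  | none => ∅
  | some i => {(ψ i).addr}

/-- The addresses on the right of `⊢` in the bases of a net. -/
def netRight {n : ℕ} (Λ : Finset Addr) (M : Fin n → Finset Addr) :
    Option (Fin n) → Finset Addr
  | none => Λ
  | some i => M i

/-- An address is a cut if it appears on the left of some base and on the right of some base. -/
def IsCut {V : Type} (L R : V → Finset Addr) (a : Addr) : Prop :=
  (∃ v, a ∈ L v) ∧ ∃ w, a ∈ R w

/-- The graph of the cuts between the bases. It may have several edges between two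
bases; so it is represented as a simple graph by subdividing each edge: every cut is a further
vertex, joined to the bases in which it appears. -/
def cutGraph {V : Type} (L R : V → Finset Addr) : SimpleGraph (V ⊕ Addr) :=
  SimpleGraph.fromRel fun x y =>
    ∃ v a, x = Sum.inl v ∧ y = Sum.inr a ∧ IsCut L R a ∧ (a ∈ L v ∨ a ∈ R v)

/-- `⟨φ | {ψ_1, …, ψ_n}⟩` is a net. -/
def IsNet {n : ℕ} (φ : Pos) (ψ : Fin n → Neg) : Prop :=
  ∃ (Λ : Finset Addr) (M : Fin n → Finset Addr),
    φ.HasBase Λ ∧ (∀ i, (ψ i).HasBase (M i)) ∧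
    (∀ v w, ∀ a ∈ netLeft ψ v ∪ netRight Λ M v, ∀ b ∈ netLeft ψ w ∪ netRight Λ M w,
      a = b ∨ Addr.Disj a b) ∧
    -- an address appears at most once on the left and at most once on the right of `⊢`
    (∀ v w, ∀ a ∈ netLeft ψ v, a ∈ netLeft ψ w → v = w) ∧
    (∀ v w, ∀ a ∈ netRight Λ M v, a ∈ netRight Λ M w → v = w) ∧
    (cutGraph (netLeft ψ) (netRight Λ M)).IsAcyclic

end Ludics

namespace Ludics

/-! ### Weak reduction is deterministic -/

/-! The componentwise order on states is a simulation for weak reduction. Let `s₁` lie below `s₂`.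
Comparable environments have the same domain, so when `s₁` reduces along an action `(+, ξ, I)`,
either the code of `s₂` is `✠`, and its normal form is the greatest element, or it is the same
action and the environment of `s₂` also accepts `ξ`. In the latter case both states reduce, and the
resulting states are again comparable.

Normal forms are invariant under reduction, so induction on a terminating reduction of `s₁` leaves
the case where `s₁` has stopped. Then the smaller normal form is `Ω`, or the larger is `✠`, or both
have the same root and their subtrees are normal forms of comparable states
(`State.ObsLE.normalFormStep_of_stopsAt`). If `s₁` never stops, its normal form is `Ω`. Coinduction
then gives the order on the whole trees (`State.ObsLE.normalForm`). -/

theorem Red.deterministic {s t u : State} (h : Red s t) (h' : Red s u) : t = u := by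
  obtain ⟨ξ, I, c, Ψ, b, hb⟩ := h
  generalize hs : (⟨Pos.act ξ I c, Ψ⟩ : State) = s at h'
  obtain ⟨ξ', I', c', Ψ', b', hb'⟩ := h'
  obtain ⟨hc, rfl⟩ := State.mk.inj hs
  obtain ⟨rfl, rfl, e⟩ := act_inj hc
  cases e
  cases hb.symm.trans hb'
  rfl

theorem StopsAt.of_red {s t u : State} (h : StopsAt s u) (hr : Red s t) : StopsAt t u := by
  rcases Relation.ReflTransGen.cases_head h.1 with rfl | ⟨v, hv, hvu⟩
  · exact absurd hr (h.2 t)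
  · exact hv.deterministic hr ▸ ⟨hvu, h.2⟩

theorem StopsAt.head {s t u : State} (hr : Red s t) (h : StopsAt t u) : StopsAt s u :=
  ⟨.head hr h.1, h.2⟩

/-- By determinism, any other stopping reduction follows the same path. This makes the state chosen
in `head` independent of the choice. -/
theorem StopsAt.unique {s t u : State} (ht : StopsAt s t) (hu : StopsAt s u) : t = u := by
  induction ht.1 using Relation.ReflTransGen.head_induction_on with
  | refl =>
    rcases Relation.ReflTransGen.cases_head hu.1 with h | ⟨v, hv, -⟩
    · exact h
    · exact absurd hv (ht.2 v)
  | head hr hrest ih => exact ih ⟨hrest, ht.2⟩ (hu.of_red hr)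

theorem not_red_daimon (Ψ : Env) (t : State) : ¬ Red ⟨Pos.daimon, Ψ⟩ t := by
  intro h
  generalize hs : (⟨Pos.daimon, Ψ⟩ : State) = s at h
  obtain ⟨ξ, I, c, Ψ', b, hb⟩ := h
  exact act_ne_daimon (State.mk.inj hs).1.symm

theorem not_red_act {ξ : Addr} {I : Finset ℕ} {c : I → Finset ℕ → Pos} {Ψ : Env}
    (hΨ : Ψ ξ = none) (t : State) : ¬ Red ⟨Pos.act ξ I c, Ψ⟩ t := by
  intro h
  generalize hs : (⟨Pos.act ξ I c, Ψ⟩ : State) = s at h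
  obtain ⟨ξ', I', c', Ψ', b, hb⟩ := h
  obtain ⟨hc, rfl⟩ := State.mk.inj hs
  obtain ⟨rfl, -, -⟩ := act_inj hc
  simp [hΨ] at hb

/-! ### Computing normal forms -/

theorem head_of_stopsAt {s t : State} (h : StopsAt s t) :
    head s = PosF.map (fun φ => (⟨φ, t.env⟩ : State)) (PFunctor.M.dest t.code) := by
  have hex : ∃ t, StopsAt s t := ⟨t, h⟩
  have e : hex.choose = t := hex.choose_spec.unique h
  rw [head, dif_pos hex, e]

theorem State.normalForm_eq (s : State) :
    s.normalForm = PFunctor.M.mk (PosF.map State.normalForm (head s)) := by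
  rw [← PFunctor.M.mk_dest s.normalForm, State.normalForm, PFunctor.M.dest_corec]
  rfl

theorem State.normalForm_of_not_stopsAt {s : State} (h : ¬ ∃ t, StopsAt s t) :
    s.normalForm = Pos.omega := by
  rw [State.normalForm_eq, head, dif_neg h, Pos.omega]
  congr 1
  -- A leaf has no subtrees: functions out of `Empty` agree.
  exact Sigma.ext rfl (heq_of_eq (funext fun e => Empty.elim e))

theorem State.normalForm_of_stopsAt_omega {s : State} {Ψ : Env}
    (h : StopsAt s ⟨Pos.omega, Ψ⟩) : s.normalForm = Pos.omega := by
  rw [State.normalForm_eq, head_of_stopsAt h]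
  simp only [Pos.omega, PFunctor.M.dest_mk]
  congr 1
  exact Sigma.ext rfl (heq_of_eq (funext fun e => Empty.elim e))

theorem State.normalForm_of_stopsAt_daimon {s : State} {Ψ : Env}
    (h : StopsAt s ⟨Pos.daimon, Ψ⟩) : s.normalForm = Pos.daimon := by
  rw [State.normalForm_eq, head_of_stopsAt h]
  simp only [Pos.daimon, PFunctor.M.dest_mk]
  congr 1
  exact Sigma.ext rfl (heq_of_eq (funext fun e => Empty.elim e))

theorem State.normalForm_of_stopsAt_act {s : State} {ξ : Addr} {I : Finset ℕ}
    {c : I → Finset ℕ → Pos} {Ψ : Env} (h : StopsAt s ⟨Pos.act ξ I c, Ψ⟩) :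
    s.normalForm = Pos.act ξ I fun i J => State.normalForm ⟨c i J, Ψ⟩ := by
  rw [State.normalForm_eq, head_of_stopsAt h]
  simp only [Pos.act, PFunctor.M.dest_mk]
  rfl

/-! ### The observational order on environments and states -/

/-- Environments with the same domain, compared pointwise. -/
def Env.ObsLE (Ψ₁ Ψ₂ : Env) : Prop :=
  ∀ ζ, Option.Rel (fun b₁ b₂ => ∀ J, Pos.ObsLE (b₁ J) (b₂ J)) (Ψ₁ ζ) (Ψ₂ ζ)

/-- States compared componentwise. -/
def State.ObsLE (s₁ s₂ : State) : Prop :=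
  Pos.ObsLE s₁.code s₂.code ∧ Env.ObsLE s₁.env s₂.env

theorem Env.ObsLE.ofFamily {ι : Type} {ψ₁ ψ₂ : ι → Neg} (h : ∀ i, Neg.ObsLE (ψ₁ i) (ψ₂ i)) :
    Env.ObsLE (Env.ofFamily ψ₁) (Env.ofFamily ψ₂) := by
  intro ζ
  have e : (fun i => (ψ₁ i).addr = ζ) = fun i => (ψ₂ i).addr = ζ :=
    funext fun i => by rw [(h i).1]
  unfold Env.ofFamily
  by_cases h₁ : ∃ i, (ψ₁ i).addr = ζ
  · have h₂ : ∃ i, (ψ₂ i).addr = ζ := e ▸ h₁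
    -- The two predicates on indices are equal, so choice returns the same index on both sides;
    -- distinctness of the addresses plays no role.
    have hc : h₁.choose = h₂.choose := by congr 1
    rw [dif_pos h₁, dif_pos h₂, hc]
    exact .some (h _).2
  · have h₂ : ¬ ∃ i, (ψ₂ i).addr = ζ := e ▸ h₁
    rw [dif_neg h₁, dif_neg h₂]
    exact .none

theorem Env.ObsLE.erase {Ψ₁ Ψ₂ : Env} (h : Env.ObsLE Ψ₁ Ψ₂) (ξ : Addr) :
    Env.ObsLE (Ψ₁.erase ξ) (Ψ₂.erase ξ) := by
  intro ζ
  unfold Env.erase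
  split_ifs
  · exact .none
  · exact h ζ

/-- Since `Ψ₁'` and `Ψ₂'` have the same domain, both unions take their value at a given address from
the same side. -/
theorem Env.ObsLE.union {Ψ₁ Ψ₂ Ψ₁' Ψ₂' : Env} (h' : Env.ObsLE Ψ₁' Ψ₂') (h : Env.ObsLE Ψ₁ Ψ₂) :
    Env.ObsLE (Ψ₁'.union Ψ₁) (Ψ₂'.union Ψ₂) := by
  intro ζ
  unfold Env.union
  generalize Ψ₁' ζ = x, Ψ₂' ζ = y, h' ζ = hxy
  cases hxy with
  | some hb => exact .some hb
  | none => simpa using h ζ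

/-! ### Monotonicity -/

/-- What the observational order says about the normal forms of two states, one level deep. -/
def NormalFormStep (s₁ s₂ : State) : Prop :=
  s₁.normalForm = Pos.omega ∨ s₂.normalForm = Pos.daimon ∨
    ∃ (ξ : Addr) (I : Finset ℕ) (c₁ c₂ : I → Finset ℕ → State),
      s₁.normalForm = Pos.act ξ I (fun i J => (c₁ i J).normalForm) ∧
      s₂.normalForm = Pos.act ξ I (fun i J => (c₂ i J).normalForm) ∧
      ∀ i J, State.ObsLE (c₁ i J) (c₂ i J)

/-- The two states stop in the same state or not at all, and `head` depends only on that. -/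
theorem State.normalForm_eq_of_red {s t : State} (hr : Red s t) :
    s.normalForm = t.normalForm := by
  by_cases h : ∃ u, StopsAt t u
  · obtain ⟨u, hu⟩ := h
    rw [State.normalForm_eq s, State.normalForm_eq t, head_of_stopsAt hu,
      head_of_stopsAt (StopsAt.head hr hu)]
  · rw [State.normalForm_of_not_stopsAt h, State.normalForm_of_not_stopsAt]
    rintro ⟨u, hu⟩
    exact h ⟨u, hu.of_red hr⟩

/-- Induction on the reduction of the smaller state, with the larger one varying: the larger state
matches every step until its code becomes `✠`, where it may stop early. -/
theorem State.ObsLE.normalFormStep_of_stopsAt {s₁ s₂ t : State} (h : State.ObsLE s₁ s₂)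
    (ht : StopsAt s₁ t) : NormalFormStep s₁ s₂ := by
  induction ht.1 using Relation.ReflTransGen.head_induction_on generalizing s₂ with
  | refl =>
    obtain ⟨φ₁, Ψ₁⟩ := t
    obtain ⟨φ₂, Ψ₂⟩ := s₂
    obtain ⟨hφ, hΨ⟩ := h
    dsimp only at hφ hΨ
    rcases hφ.unfold with rfl | rfl | ⟨ξ, I, c₁, c₂, rfl, rfl, hc⟩
    · exact .inl (State.normalForm_of_stopsAt_omega ht)
    · exact .inr (.inl (State.normalForm_of_stopsAt_daimon ⟨.refl, not_red_daimon Ψ₂⟩))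
    · have hξ₁ : Ψ₁ ξ = none := by
        by_contra hne
        obtain ⟨b, hb⟩ := Option.ne_none_iff_exists'.1 hne
        exact ht.2 _ (.rule ξ I c₁ Ψ₁ b hb)
      have hξ₂ : Ψ₂ ξ = none := by
        have := hΨ ξ
        rw [hξ₁] at this
        generalize Ψ₂ ξ = y at this
        cases this
        rfl
      exact .inr (.inr ⟨ξ, I, fun i J => ⟨c₁ i J, Ψ₁⟩, fun i J => ⟨c₂ i J, Ψ₂⟩,
        State.normalForm_of_stopsAt_act ht,
        State.normalForm_of_stopsAt_act ⟨.refl, not_red_act hξ₂⟩, fun i J => ⟨hc i J, hΨ⟩⟩)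
  | head hr hrest ih =>
    obtain ⟨φ₂, Ψ₂⟩ := s₂
    have hnf := State.normalForm_eq_of_red hr
    obtain ⟨ξ, I, c₁, Ψ₁, b₁, hb₁⟩ := hr
    obtain ⟨hφ, hΨ⟩ := h
    dsimp only at hφ hΨ
    rcases hφ.unfold with h₀ | rfl | ⟨ξ', I', c₁', c₂, h₁, rfl, hc⟩
    -- A state with code `Ω` has no reduction step.
    · exact absurd h₀ act_ne_omega
    · exact .inr (.inl (State.normalForm_of_stopsAt_daimon ⟨.refl, not_red_daimon Ψ₂⟩))
    · obtain ⟨rfl, rfl, e⟩ := act_inj h₁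
      cases e
      obtain ⟨b₂, hb₂, hb⟩ : ∃ b₂, Ψ₂ ξ = some b₂ ∧ ∀ J, Pos.ObsLE (b₁ J) (b₂ J) := by
        have := hΨ ξ
        rw [hb₁] at this
        generalize Ψ₂ ξ = y at this
        cases this with
        | some hb => exact ⟨_, rfl, hb⟩
      have hr₂ := Red.rule ξ I c₂ Ψ₂ b₂ hb₂
      -- The contracted states are comparable: the selected branches `b₁ I` and `b₂ I`, the new
      -- families and the remaining environments are.
      have hstep := ih (s₂ := ⟨b₂ I, _⟩) ⟨hb I, Env.ObsLE.union
        (Env.ObsLE.ofFamily (ψ₂ := fun i : I => ⟨ξ ++ [(i : ℕ)], c₂ i⟩) fun i => ⟨rfl, hc i⟩)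
        (hΨ.erase ξ)⟩ ⟨hrest, ht.2⟩
      unfold NormalFormStep at hstep ⊢
      rwa [hnf, State.normalForm_eq_of_red hr₂]

theorem State.ObsLE.normalFormStep {s₁ s₂ : State} (h : State.ObsLE s₁ s₂) :
    NormalFormStep s₁ s₂ := by
  by_cases ht : ∃ t, StopsAt s₁ t
  · obtain ⟨t, ht⟩ := ht
    exact h.normalFormStep_of_stopsAt ht
  · exact .inl (State.normalForm_of_not_stopsAt ht)

/-- Coinduction: the pairs of normal forms of comparable states form a relation closed under the
rules of the order, by `State.ObsLE.normalFormStep`. -/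
theorem State.ObsLE.normalForm {s₁ s₂ : State} (h : State.ObsLE s₁ s₂) :
    Pos.ObsLE s₁.normalForm s₂.normalForm := by
  refine ⟨fun φ φ' => ∃ s s', State.ObsLE s s' ∧ φ = s.normalForm ∧ φ' = s'.normalForm,
    ⟨s₁, s₂, h, rfl, rfl⟩, ?_⟩
  rintro _ _ ⟨s, s', hs, rfl, rfl⟩
  rcases hs.normalFormStep with h | h | ⟨ξ, I, c₁, c₂, h₁, h₂, hc⟩
  · exact .inl h
  · exact .inr (.inl h)
  · exact .inr (.inr ⟨ξ, I, _, _, h₁, h₂, fun i J => ⟨_, _, hc i J, rfl, rfl⟩⟩)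

end Ludics

theorem mainTheorem8 {n : ℕ} (φ₁ φ₂ : Ludics.Pos) (ψ₁ ψ₂ : Fin n → Ludics.Neg)
    (hnet₁ : Ludics.IsNet φ₁ ψ₁) (hnet₂ : Ludics.IsNet φ₂ ψ₂)
    (hφ : Ludics.Pos.ObsLE φ₁ φ₂) (hψ : ∀ i, Ludics.Neg.ObsLE (ψ₁ i) (ψ₂ i)) :
    Ludics.Pos.ObsLE (Ludics.normalForm φ₁ ψ₁) (Ludics.normalForm φ₂ ψ₂) :=
  Ludics.State.ObsLE.normalForm ⟨hφ, Ludics.Env.ObsLE.ofFamily hψ⟩
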